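/- Let $d,q\ge 1$, $T,A>0$, $0<\alpha\le 2$, and write $W=[-A,A]^d$, $S=[-T,T]^q$. Let $M$ be an (independently scattered) $\alpha$-stable random measure on $\mathbb{R}^d$ with control measure $m$ and measurable skewness intensity $\beta:\mathbb{R}^d\to[-1,1]$, defined on a probability space. That is, for Borel sets $B$ with $m(B)<\infty$, $$M(B)\sim S_\alpha\Big(m(B)^{1/\alpha},\ \tfrac{1}{m(B)}\int_B\beta\,dm,\ 0\Big)$$ (the stable law with index $\alpha$, given scale, skewness and location; $M(B)=0$ a.s. if $m(B)=0$), the values of $M$ on disjoint sets are independent, and for disjoint $B_1,B_2,\dots$ with $m(B_i)<\infty$ and $m(\bigcup_i B_i)<\infty$ one has $M(\bigcup_i B_i)=\sum_i M(B_i)$ a.s. If $\alpha=1$, assume $m(W)<\infty$ (which holds automatically if $m$ is finite on bounded sets). For $D\subseteq\mathbb{R}^d$ Borel, the stochastic integral $\int_D f\,dM$ is the limit in probability of $\int_D g_k\,dM$, where the $g_k$ are simple functions, nonzero only on a set of finite $m$-measure, such that $g_k\to f$ $m$-a.e. and $\int_B g_k\,dM$ converges in probability for every Borel set $B$. Let $\mathcal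 F$ be the set of $f\in L^\alpha(\mathbb{R}^d,m)$ which, if $\alpha=1$, also satisfy $\int |f\ln|f||\,dm<\infty$. For $t\in S$ and $n\in\mathbb{N}$ let $f_t,\tilde f^{(n)}_t\in\mathcal F$, where $f_t$ vanishes outside $W$, and let $$X(t)=\int_{\mathbb{R}^d}f_t\,dM,\qquad \tilde X^{(n)}(t)=\int_{W}\tilde f^{(n)}_t\,dM .$$ For $s>0$ put $$\mathrm{Err}_s(X(t),\tilde X^{(n)}(t))=\Big(\int_W|f_t-\tilde f^{(n)}_t|^s\,dm\Big)^{1/s}\in[0,\infty].$$ Suppose that $\mathrm{Err}_s(X(t),\tilde X^{(n)}(t))\to0$ as $n\to\infty$ for every $t\in S$, where - $s=\alpha$ if $\alpha\neq1$; - $s=3/2$ if $\alpha=1$; if $\alpha=1$ and moreover $\beta=0$ $m$-a.e. on $W$, one may take either $s=1$ or $s=3/2$. Then $\{\tilde X^{(n)}(t)\}_{t\in S}$ converges to $\{X(t)\}_{t\in S}$ in all finite-dimensional distributions: for all $t_1,\dots,t_k\in S$, the random vectors $(\tilde X^{(n)}(t_1),\dots,\tilde X^{(n)}(t_k))$ converge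 in distribution to $(X(t_1),\dots,X(t_k))$ as $n\to\infty$. -/

import Mathlib

open MeasureTheory ProbabilityTheory Filter Topology
open scoped ENNReal

noncomputable section

namespace StableField

/-- Characteristic function of the stable distribution `S_α(σ, b, μ)` with index `α`, scale `σ`,
skewness `b` and location `μ`. -/
def stableCharFun (α σ b μ θ : ℝ) : ℂ :=
  if α = 1 then
    Complex.exp (-((σ * |θ| : ℝ) : ℂ) *
      (1 + Complex.I * ((b * (2 / Real.pi) * Real.sign θ * Real.log |θ| : ℝ) : ℂ))
      + Complex.I * ((μ * θ : ℝ) : ℂ))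
  else
    Complex.exp (-((σ ^ α * |θ| ^ α : ℝ) : ℂ) *
      (1 - Complex.I * ((b * Real.sign θ * Real.tan (Real.pi * α / 2) : ℝ) : ℂ))
      + Complex.I * ((μ * θ : ℝ) : ℂ))

/-- The real random variable `Y` has the stable distribution `S_α(σ, b, μ)`. -/
def HasStableLaw {Ω : Type*} [MeasurableSpace Ω] (P : Measure Ω) (Y : Ω → ℝ)
    (α σ b μ : ℝ) : Prop :=
  AEMeasurable Y P ∧ ∀ θ : ℝ, charFun (P.map Y) θ = stableCharFun α σ b μ θ

/-- `M` is an independently scattered `α`-stable random measure on `E` with control measure `m` and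
skewness intensity `β`. It lives on the measurable sets of finite `m`-measure; the values of `M` on
other sets play no role. Countable additivity is almost sure convergence of the partial sums (not
absolute convergence, which fails for some disjoint sequences when `1 ≤ α`). -/
structure IsStableRandomMeasure {Ω E : Type*} [MeasurableSpace Ω] [MeasurableSpace E]
    (P : Measure Ω) (α : ℝ) (m : Measure E) (β : E → ℝ) (M : Set E → Ω → ℝ) : Prop where
  measurable_skewness : Measurable β
  abs_skewness_le : ∀ x, |β x| ≤ 1
  law : ∀ B : Set E, MeasurableSet B → m B < ∞ →
    HasStableLaw P (M B) α (m.real B ^ (1 / α)) ((∫ x in B, β x ∂m) / m.real B) 0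
  indep : ∀ (k : ℕ) (B : Fin k → Set E), (∀ i, MeasurableSet (B i)) → (∀ i, m (B i) < ∞) →
    Pairwise (Function.onFun Disjoint B) → iIndepFun (fun i => M (B i)) P
  additive : ∀ B : ℕ → Set E, (∀ i, MeasurableSet (B i)) → (∀ i, m (B i) < ∞) →
    Pairwise (Function.onFun Disjoint B) → m (⋃ i, B i) < ∞ →
    ∀ᵐ ω ∂P, Tendsto (fun n : ℕ => ∑ i ∈ Finset.range n, M (B i) ω) atTop
      (𝓝 (M (⋃ i, B i) ω))

/-- `∫_B g dM = ∑ c, c M({g = c} ∩ B)` for a simple function `g`. -/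
def simpleIntegral {Ω E : Type*} [MeasurableSpace E] (M : Set E → Ω → ℝ)
    (g : SimpleFunc E ℝ) (B : Set E) (ω : Ω) : ℝ :=
  ∑ c ∈ g.range, c * M (g ⁻¹' {c} ∩ B) ω

/-- `f` is `M`-integrable and `Y` is (a version of) the stochastic integral `∫_D f dM`: there are
simple functions `g k`, supported on sets of finite `m`-measure, with `g k → f` `m`-a.e., such that
`∫_B g k dM` converges in probability for every measurable `B`, and `∫_D g k dM → Y` in
probability. -/
def IsStochasticIntegral {Ω E : Type*} [MeasurableSpace Ω] [MeasurableSpace E]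
    (P : Measure Ω) (m : Measure E) (M : Set E → Ω → ℝ) (f : E → ℝ) (D : Set E)
    (Y : Ω → ℝ) : Prop :=
  ∃ g : ℕ → SimpleFunc E ℝ,
    (∀ k, (g k).FinMeasSupp m) ∧
    (∀ᵐ x ∂m, Tendsto (fun k => g k x) atTop (𝓝 (f x))) ∧
    (∀ B : Set E, MeasurableSet B →
      ∃ Z : Ω → ℝ, TendstoInMeasure P (fun k => simpleIntegral M (g k) B) atTop Z) ∧
    TendstoInMeasure P (fun k => simpleIntegral M (g k) D) atTop Y

/-- The class of kernels: `f ∈ L^α(m)`, and if `α = 1` also `∫ |f ln |f|| dm < ∞`. -/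
def IsKernel {E : Type*} [MeasurableSpace E] (α : ℝ) (m : Measure E) (f : E → ℝ) : Prop :=
  MemLp f (ENNReal.ofReal α) m ∧
    (α = 1 → Integrable (fun x => f x * Real.log |f x|) m)

/-- The cube `[-r, r]^k`. -/
def cube (k : ℕ) (r : ℝ) : Set (Fin k → ℝ) := Set.Icc (fun _ => -r) (fun _ => r)

/-- `(∫_W |f - g|^s dm)^(1/s)`, the error `Err_s` between the random variables with kernels `f`
and `g`; it may be infinite. -/
def kernelErr {E : Type*} [MeasurableSpace E] (m : Measure E) (W : Set E) (s : ℝ)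
    (f g : E → ℝ) : ℝ≥0∞ :=
  (∫⁻ x in W, ENNReal.ofReal (|f x - g x| ^ s) ∂m) ^ (1 / s)

/-- `s` is an admissible exponent of the error measure: `s = α` if `α ≠ 1` or the skewness
intensity vanishes on `W`, and `s = 3 / 2` whenever `α = 1`. -/
def IsErrExponent {E : Type*} [MeasurableSpace E] (α : ℝ) (m : Measure E) (W : Set E)
    (β : E → ℝ) (s : ℝ) : Prop :=
  (s = α ∧ (α ≠ 1 ∨ ∀ᵐ x ∂(m.restrict W), β x = 0)) ∨ (s = 3 / 2 ∧ α = 1)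

/-- Convergence of all finite-dimensional distributions of `Y n`, `n → ∞`, to those of `X`, on the
index set `S`. -/
def TendstoFiniteDim {Ω ι : Type*} [MeasurableSpace Ω] (P : Measure Ω) [IsProbabilityMeasure P]
    (S : Set ι) (Y : ℕ → ι → Ω → ℝ) (X : ι → Ω → ℝ) : Prop :=
  ∀ (k : ℕ) (τ : Fin k → ι), (∀ j, τ j ∈ S) →
    TendstoInDistribution (fun n ω j => Y n (τ j) ω) atTop (fun ω j => X (τ j) ω)
      (fun _ => P) P

end StableField

end

noncomputable section

namespace StableField

/-! Everything reduces to the error `X t - X' n t`. It is the stochastic integral over the whole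
space of `f - 1_W f'`, and its characteristic function at `θ` is `exp (-∫_W ψ(β, θ (f - f')) dm)`
with `ψ = stableExponent`. The admissible exponents `s` are those for which a small error forces
`∫_W |ψ|` to be small: `|ψ(b, u)|` is at most a multiple of `|u|^α` if `α ≠ 1` or `b = 0`, and of
`|u|^(1/2) + |u|^(3/2)` if `α = 1`. The characteristic functions therefore tend to 1, so the error
tends to 0 in probability for each `t`. Convergence in probability passes to vectors coordinatewise,
and it implies convergence in law.

The difficulty is the formula for the characteristic function (`IsStochasticIntegral.charFun_eq`).
The approximating simple functions converge only almost everywhere, with no domination, and their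
integrals over each set converge only in probability. A gliding hump argument
(`tendsto_cexp_neg_integral_of_exhaustion`) shows that convergence on every measurable set prevents
mass of the exponents from escaping. It works with `exp (-∫ φ)` directly, since no convergence of
the integrals `∫ φ` is known. -/

/-- The imaginary part of the characteristic exponent of a totally skewed stable law. -/
def skewPart (α u : ℝ) : ℝ :=
  if α = 1 then 2 / Real.pi * (u * Real.log u)
  else -(Real.tan (Real.pi * α / 2) * (Real.sign u * |u| ^ α))

/-- The characteristic exponent of the stable law `S_α(1, b, 0)`. -/
def stableExponent (α b u : ℝ) : ℂ :=
  ((|u| ^ α : ℝ) : ℂ) + Complex.I * ((b * skewPart α u : ℝ) : ℂ)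

/-! ### Continuity and size of the characteristic exponent -/

lemma continuous_sign_mul_abs_rpow {α : ℝ} (hα : 0 < α) :
    Continuous fun u : ℝ => Real.sign u * |u| ^ α := by
  -- Splitting into powers of the positive and negative parts removes the jump of the sign at 0.
  have h : (fun u : ℝ => Real.sign u * |u| ^ α) = fun u => (max u 0) ^ α - (max (-u) 0) ^ α := by
    funext u
    rcases lt_trichotomy u 0 with hu | rfl | hu
    · rw [Real.sign_of_neg hu, abs_of_neg hu, max_eq_right hu.le, max_eq_left (by linarith),
        Real.zero_rpow hα.ne']
      ring
    · simp [Real.zero_rpow hα.ne']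
    · rw [Real.sign_of_pos hu, abs_of_pos hu, max_eq_left hu.le, max_eq_right (by linarith),
        Real.zero_rpow hα.ne']
      ring
  rw [h]
  exact ((continuous_id.max continuous_const).rpow_const fun _ => Or.inr hα.le).sub
    ((continuous_neg.max continuous_const).rpow_const fun _ => Or.inr hα.le)

lemma continuous_skewPart {α : ℝ} (hα : 0 < α) : Continuous (skewPart α) := by
  unfold skewPart
  split_ifs
  · exact continuous_const.mul Real.continuous_mul_log
  · exact (continuous_const.mul (continuous_sign_mul_abs_rpow hα)).neg

lemma continuous_stableExponent {α : ℝ} (hα : 0 < α) :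
    Continuous fun p : ℝ × ℝ => stableExponent α p.1 p.2 := by
  unfold stableExponent
  have h1 : Continuous fun p : ℝ × ℝ => |p.2| ^ α :=
    continuous_snd.abs.rpow_const fun _ => Or.inr hα.le
  have h2 : Continuous fun p : ℝ × ℝ => p.1 * skewPart α p.2 :=
    continuous_fst.mul ((continuous_skewPart hα).comp continuous_snd)
  exact (Complex.continuous_ofReal.comp h1).add
    (continuous_const.mul (Complex.continuous_ofReal.comp h2))

@[simp] lemma skewPart_zero {α : ℝ} : skewPart α 0 = 0 := by
  simp [skewPart]

lemma stableExponent_zero {α : ℝ} (hα : 0 < α) (b : ℝ) : stableExponent α b 0 = 0 := by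
  simp [stableExponent, Real.zero_rpow hα.ne']

lemma stableExponent_re {α b u : ℝ} : (stableExponent α b u).re = |u| ^ α := by
  simp [stableExponent]

lemma stableExponent_re_nonneg {α b u : ℝ} : 0 ≤ (stableExponent α b u).re := by
  rw [stableExponent_re]; positivity

lemma norm_stableExponent_le {α b u : ℝ} :
    ‖stableExponent α b u‖ ≤ |u| ^ α + |b| * |skewPart α u| := by
  refine (norm_add_le _ _).trans (le_of_eq ?_)
  rw [norm_mul, Complex.norm_I, one_mul, Complex.norm_real, Complex.norm_real, Real.norm_eq_abs,
    Real.norm_eq_abs, abs_mul, abs_of_nonneg (by positivity : 0 ≤ |u| ^ α)]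

/-- With scale `v ^ (1 / α)` the exponent is linear in `v` and `v * b`. For `v = m(B)` and `b` the
mean of `β` over `B`, it thus becomes an integral over `B`. -/
lemma stableCharFun_eq {α v b θ : ℝ} (hα : 0 < α) (hv : 0 ≤ v) :
    stableCharFun α (v ^ (1 / α)) b 0 θ =
      Complex.exp (-(((v * |θ| ^ α : ℝ) : ℂ) + Complex.I * ((v * b * skewPart α θ : ℝ) : ℂ))) := by
  unfold stableCharFun skewPart
  split_ifs with h
  · subst h
    congr 1
    have : θ * Real.log θ = |θ| * Real.sign θ * Real.log |θ| := by
      rw [Real.log_abs]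
      rcases lt_trichotomy θ 0 with hu | rfl | hu
      · rw [Real.sign_of_neg hu, abs_of_neg hu]; ring
      · simp
      · rw [Real.sign_of_pos hu, abs_of_pos hu]; ring
    rw [this]
    simp only [Real.rpow_one, div_one]
    push_cast
    ring
  · congr 1
    rw [← Real.rpow_mul hv, one_div_mul_cancel hα.ne', Real.rpow_one]
    push_cast
    ring

/-! ### Stable random measures and integrals of simple functions -/

section

variable {Ω E : Type*} [MeasurableSpace Ω] [MeasurableSpace E] {P : Measure Ω} {α : ℝ}
  {m : Measure E} {β : E → ℝ} {M : Set E → Ω → ℝ}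

namespace IsStableRandomMeasure

lemma measurable_stableExponent (hM : IsStableRandomMeasure P α m β M) (hα : 0 < α) {f : E → ℝ}
    (hf : Measurable f) : Measurable fun x => stableExponent α (β x) (f x) :=
  (continuous_stableExponent hα).measurable.comp (hM.measurable_skewness.prodMk hf)

lemma norm_stableExponent_skewness_le (hM : IsStableRandomMeasure P α m β M) (x : E) (u : ℝ) :
    ‖stableExponent α (β x) u‖ ≤ |u| ^ α + |skewPart α u| := by
  refine norm_stableExponent_le.trans ?_
  have := mul_le_mul_of_nonneg_right (hM.abs_skewness_le x) (abs_nonneg (skewPart α u))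
  linarith

lemma integrable_stableExponent (hM : IsStableRandomMeasure P α m β M) (hα : 0 < α)
    {h : SimpleFunc E ℝ} (hh : h.FinMeasSupp m) (θ : ℝ) :
    Integrable (fun x => stableExponent α (β x) (θ * h x)) m := by
  have hG : (h.map fun u => |θ * u| ^ α + |skewPart α (θ * u)|).FinMeasSupp m :=
    hh.map (by simp [Real.zero_rpow hα.ne'])
  refine (SimpleFunc.integrable_iff_finMeasSupp.2 hG).mono'
    (hM.measurable_stableExponent hα (h.measurable.const_mul θ)).aestronglyMeasurable ?_
  exact ae_of_all _ fun x => hM.norm_stableExponent_skewness_le x _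

lemma aemeasurable (hM : IsStableRandomMeasure P α m β M) {B : Set E} (hB : MeasurableSet B)
    (hmB : m B < ∞) : AEMeasurable (M B) P :=
  (hM.law B hB hmB).1

lemma charFun_map (hM : IsStableRandomMeasure P α m β M) (hα : 0 < α) {B : Set E}
    (hB : MeasurableSet B) (hmB : m B < ∞) (θ : ℝ) :
    charFun (P.map (M B)) θ = Complex.exp (-∫ x in B, stableExponent α (β x) θ ∂m) := by
  have : IsFiniteMeasure (m.restrict B) := ⟨by simpa using hmB⟩
  rw [(hM.law B hB hmB).2, stableCharFun_eq hα measureReal_nonneg]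
  have hβ : Integrable β (m.restrict B) :=
    Integrable.of_bound hM.measurable_skewness.aestronglyMeasurable 1
      (ae_of_all _ hM.abs_skewness_le)
  -- On a null set the quotient is 0 by convention, and the integral vanishes as well.
  have hv : m.real B * ((∫ x in B, β x ∂m) / m.real B) = ∫ x in B, β x ∂m := by
    rcases eq_or_ne (m.real B) 0 with h0 | h0
    · have : m B = 0 := by
        simpa [measureReal_def, ENNReal.toReal_eq_zero_iff, hmB.ne] using h0
      simp [Measure.restrict_eq_zero.2 this]
    · field_simp
  rw [hv]
  congr 2
  unfold stableExponent
  rw [integral_add (integrable_const _) ((hβ.mul_const _).ofReal.const_mul _), integral_const,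
    integral_const_mul, integral_complex_ofReal, integral_mul_const]
  simp

/-- Additivity for the constant sequence `∅` makes `n * M ∅` converge, so its increments `M ∅` tend
to 0. -/
lemma ae_empty (hM : IsStableRandomMeasure P α m β M) : ∀ᵐ ω ∂P, M ∅ ω = 0 := by
  filter_upwards [hM.additive (fun _ => ∅) (by simp) (by simp) (fun i j _ => by simp [Function.onFun])
    (by simp)] with ω hω
  simp only [Set.iUnion_empty, Finset.sum_const, Finset.card_range, nsmul_eq_mul] at hω
  have h1 : Tendsto (fun n : ℕ => ((n + 1 : ℕ) : ℝ) * M ∅ ω - (n : ℝ) * M ∅ ω) atTop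
      (𝓝 (M ∅ ω - M ∅ ω)) := (hω.comp (tendsto_add_atTop_nat 1)).sub hω
  rw [sub_self] at h1
  refine tendsto_nhds_unique (tendsto_const_nhds.congr fun n => ?_) h1
  push_cast; ring

lemma ae_union (hM : IsStableRandomMeasure P α m β M) {A B : Set E} (hA : MeasurableSet A)
    (hB : MeasurableSet B) (hmA : m A < ∞) (hmB : m B < ∞) (hAB : Disjoint A B) :
    ∀ᵐ ω ∂P, M (A ∪ B) ω = M A ω + M B ω := by
  let C : ℕ → Set E := fun i => if i = 0 then A else if i = 1 then B else ∅
  have hU : ⋃ i, C i = A ∪ B := by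
    ext x
    simp only [Set.mem_iUnion, Set.mem_union, C]
    constructor
    · rintro ⟨i, hi⟩
      split_ifs at hi
      · exact Or.inl hi
      · exact Or.inr hi
      · exact hi.elim
    · rintro (h | h)
      · exact ⟨0, by simpa using h⟩
      · exact ⟨1, by simpa using h⟩
  filter_upwards [hM.ae_empty, hM.additive C
    (fun i => by dsimp only [C]; split_ifs <;> simp [hA, hB])
    (fun i => by dsimp only [C]; split_ifs <;> simp [hmA, hmB])
    (fun i j hij => by
      dsimp only [C, Function.onFun]
      split_ifs <;> first | omega | simp [hAB.symm])
    (by rw [hU]; exact (measure_union_le A B).trans_lt (ENNReal.add_lt_top.2 ⟨hmA, hmB⟩))]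
    with ω h0 hω
  rw [hU] at hω
  refine tendsto_nhds_unique hω (tendsto_const_nhds.congr' ?_)
  filter_upwards [eventually_ge_atTop 2] with n hn
  rw [← Finset.sum_range_add_sum_Ico _ hn, Finset.sum_eq_zero (s := Finset.Ico 2 n)]
  · simp [Finset.sum_range_succ, C]
  · intro i hi
    have : 2 ≤ i := (Finset.mem_Ico.1 hi).1
    have h1 : C i = ∅ := by
      dsimp only [C]
      rw [if_neg (by omega), if_neg (by omega)]
    rw [h1, h0]

lemma ae_biUnion {ι : Type*} (hM : IsStableRandomMeasure P α m β M) (s : Finset ι)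
    {A : ι → Set E} (hA : ∀ i ∈ s, MeasurableSet (A i)) (hmA : ∀ i ∈ s, m (A i) < ∞)
    (hd : (s : Set ι).PairwiseDisjoint A) :
    ∀ᵐ ω ∂P, M (⋃ i ∈ s, A i) ω = ∑ i ∈ s, M (A i) ω := by
  classical
  induction s using Finset.induction_on with
  | empty => simpa using hM.ae_empty
  | insert a s ha ih =>
    have hdis : Disjoint (A a) (⋃ i ∈ s, A i) := by
      rw [Set.disjoint_iUnion₂_right]
      intro i hi
      exact hd (by simp) (by simp [hi]) (by rintro rfl; exact ha hi)
    filter_upwards [ih (fun i hi => hA i (by simp [hi])) (fun i hi => hmA i (by simp [hi]))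
        (hd.subset (by simp)),
      hM.ae_union (hA a (by simp)) (s.measurableSet_biUnion fun i hi => hA i (by simp [hi]))
        (hmA a (by simp))
        (measure_biUnion_lt_top s.finite_toSet fun i hi => hmA i (by simp_all)) hdis] with ω h1 h2
    rw [Finset.set_biUnion_insert, h2, h1, Finset.sum_insert ha]

end IsStableRandomMeasure

lemma aemeasurable_simpleIntegral (hM : IsStableRandomMeasure P α m β M) {h : SimpleFunc E ℝ}
    (hh : h.FinMeasSupp m) {B : Set E} (hB : MeasurableSet B) :
    AEMeasurable (simpleIntegral M h B) P := by
  unfold simpleIntegral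
  refine Finset.aemeasurable_fun_sum _ fun c _ => ?_
  rcases eq_or_ne c 0 with rfl | hc
  · simp
  · exact (hM.aemeasurable ((h.measurableSet_preimage _).inter hB)
      ((measure_mono Set.inter_subset_left).trans_lt
        (hh.meas_preimage_singleton_ne_zero hc))).const_mul c

lemma charFun_simpleIntegral [IsProbabilityMeasure P] (hM : IsStableRandomMeasure P α m β M)
    (hα : 0 < α) {h : SimpleFunc E ℝ}
    (hh : h.FinMeasSupp m) {B : Set E} (hB : MeasurableSet B) (θ : ℝ) :
    charFun (P.map (simpleIntegral M h B)) θ =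
      Complex.exp (-∫ x in B, stableExponent α (β x) (θ * h x) ∂m) := by
  classical
  -- The value 0 is discarded: its level set may have infinite measure, where nothing is known about
  -- `M`.
  set s := h.range.filter (· ≠ 0) with hs
  set A : ℝ → Set E := fun c => h ⁻¹' {c} ∩ B with hAdef
  have hA : ∀ c, MeasurableSet (A c) := fun c => (h.measurableSet_preimage _).inter hB
  have hmA : ∀ c ∈ s, m (A c) < ∞ := fun c hc => (measure_mono Set.inter_subset_left).trans_lt
    (hh.meas_preimage_singleton_ne_zero (Finset.mem_filter.1 hc).2)
  have hd : Pairwise (Function.onFun Disjoint A) := fun a b hab => by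
    refine Set.disjoint_left.2 fun x hx hx' => hab ?_
    exact (Set.mem_singleton_iff.1 hx.1).symm.trans (Set.mem_singleton_iff.1 hx'.1)
  have hsum : simpleIntegral M h B = fun ω => ∑ c ∈ s, c * M (A c) ω := by
    funext ω
    rw [simpleIntegral, hs, Finset.sum_filter_of_ne]
    intro c _ hc h0
    simp [h0] at hc
  have hind : iIndepFun (fun c : s => M (A c)) P := by
    have := hM.indep s.card (fun i => A (s.equivFin.symm i)) (fun i => hA _)
      (fun i => hmA _ (s.equivFin.symm i).2)
      (fun i j hij => hd fun h => hij (s.equivFin.symm.injective (Subtype.ext h)))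
    exact iIndepFun.of_precomp (g := s.equivFin.symm) s.equivFin.symm.surjective this
  have hind' : iIndepFun (s.restrict fun c ω => c * M (A c) ω) P :=
    hind.comp (fun c y => (c : ℝ) * y) fun c => measurable_const_mul _
  rw [hsum, hind'.charFun_map_fun_finsetSum_eq_prod
    (fun c hc => (hM.aemeasurable (hA c) (hmA c hc)).const_mul c), Finset.prod_apply,
    Finset.prod_congr rfl (fun c hc => by
      rw [charFun_map_mul_comp (hM.aemeasurable (hA c) (hmA c hc)),
        hM.charFun_map hα (hA c) (hmA c hc)]), ← Complex.exp_sum, Finset.sum_neg_distrib]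
  congr 2
  have hint := hM.integrable_stableExponent hα hh θ
  have hsub : (⋃ c ∈ s, A c) ⊆ B := Set.iUnion₂_subset fun _ _ => Set.inter_subset_right
  rw [setIntegral_eq_of_subset_of_forall_sdiff_eq_zero hB hsub,
    integral_biUnion_finset s (fun c _ => hA c) (fun a _ b _ hab => hd hab)
      (fun c _ => hint.integrableOn)]
  · refine Finset.sum_congr rfl fun c _ => setIntegral_congr_fun (hA c) fun x hx => ?_
    have : h x = c := hx.1
    simp only [this, mul_comm]
  · rintro x ⟨hxB, hx⟩
    have : h x = 0 := by
      by_contra h0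
      refine hx (Set.mem_iUnion₂.2 ⟨h x, ?_, rfl, hxB⟩)
      simp [hs, h0]
    rw [this, mul_zero, stableExponent_zero hα]

/-- Finite additivity makes the integral independent of the partition used. This is what linearity
needs: the level sets of a difference are unions of joint level sets. -/
lemma simpleIntegral_map {γ : Type*} (hM : IsStableRandomMeasure P α m β M) (p : SimpleFunc E γ)
    (F : γ → ℝ) (hp : ∀ c, F c ≠ 0 → m (p ⁻¹' {c}) < ∞) {B : Set E} (hB : MeasurableSet B) :
    simpleIntegral M (p.map F) B =ᵐ[P] fun ω => ∑ c ∈ p.range, F c * M (p ⁻¹' {c} ∩ B) ω := by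
  classical
  have key : ∀ r ∈ (p.map F).range, ∀ᵐ ω ∂P, r * M ((p.map F) ⁻¹' {r} ∩ B) ω =
      ∑ c ∈ p.range with F c = r, F c * M (p ⁻¹' {c} ∩ B) ω := by
    intro r _
    rcases eq_or_ne r 0 with rfl | hr
    · refine ae_of_all _ fun ω => ?_
      rw [zero_mul, Finset.sum_eq_zero]
      intro c hc
      rw [(Finset.mem_filter.1 hc).2, zero_mul]
    · have hU : (p.map F) ⁻¹' {r} ∩ B = ⋃ c ∈ p.range.filter (F · = r), p ⁻¹' {c} ∩ B := by
        ext x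
        simp only [Set.mem_inter_iff, Set.mem_preimage, SimpleFunc.map_apply,
          Set.mem_singleton_iff, Finset.mem_filter, Set.mem_iUnion, exists_prop]
        constructor
        · rintro ⟨h1, h2⟩
          exact ⟨p x, ⟨p.mem_range_self x, h1⟩, rfl, h2⟩
        · rintro ⟨c, ⟨_, h1⟩, rfl, h2⟩
          exact ⟨h1, h2⟩
      filter_upwards [hM.ae_biUnion (p.range.filter (F · = r)) (A := fun c => p ⁻¹' {c} ∩ B)
        (fun c _ => (p.measurableSet_preimage _).inter hB)
        (fun c hc => (measure_mono Set.inter_subset_left).trans_lt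
          (hp c (by rw [(Finset.mem_filter.1 hc).2]; exact hr)))
        (fun a _ b _ hab => Set.disjoint_left.2 fun x hx hx' => hab
          ((Set.mem_singleton_iff.1 hx.1).symm.trans (Set.mem_singleton_iff.1 hx'.1)))] with ω hω
      rw [hU, hω, Finset.mul_sum]
      exact Finset.sum_congr rfl fun c hc => by rw [(Finset.mem_filter.1 hc).2]
  filter_upwards [(Filter.eventually_all_finset _).2 key] with ω hω
  rw [simpleIntegral, Finset.sum_congr rfl hω]
  refine Finset.sum_fiberwise_of_maps_to (fun c hc => ?_) _
  rw [SimpleFunc.range_map]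
  exact Finset.mem_image_of_mem F hc

lemma simpleIntegral_sub (hM : IsStableRandomMeasure P α m β M) {g h : SimpleFunc E ℝ}
    (hg : g.FinMeasSupp m) (hh : h.FinMeasSupp m) {B : Set E} (hB : MeasurableSet B) :
    simpleIntegral M (g - h) B =ᵐ[P] fun ω => simpleIntegral M g B ω - simpleIntegral M h B ω := by
  set p := g.pair h
  have h1 : g = p.map Prod.fst := rfl
  have h2 : h = p.map Prod.snd := rfl
  have h3 : g - h = p.map fun c => c.1 - c.2 := rfl
  have hp : ∀ c : ℝ × ℝ, c ≠ 0 → m (p ⁻¹' {c}) < ∞ := fun c hc =>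
    (hg.pair hh).meas_preimage_singleton_ne_zero hc
  have e1 := simpleIntegral_map hM p Prod.fst
    (fun c hc => hp c (by rintro rfl; exact hc rfl)) hB
  have e2 := simpleIntegral_map hM p Prod.snd
    (fun c hc => hp c (by rintro rfl; exact hc rfl)) hB
  have e3 := simpleIntegral_map hM p (fun c => c.1 - c.2)
    (fun c hc => hp c (by rintro rfl; exact hc (by simp))) hB
  rw [← h1] at e1
  rw [← h2] at e2
  rw [← h3] at e3
  filter_upwards [e1, e2, e3] with ω h1 h2 h3
  rw [h1, h2, h3, ← Finset.sum_sub_distrib]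
  exact Finset.sum_congr rfl fun c _ => by ring

lemma simpleIntegral_restrict (hM : IsStableRandomMeasure P α m β M) (g : SimpleFunc E ℝ)
    {W : Set E} (hW : MeasurableSet W) (B : Set E) :
    simpleIntegral M (g.restrict W) B =ᵐ[P] simpleIntegral M g (B ∩ W) := by
  classical
  filter_upwards [hM.ae_empty] with ω h0
  have hset : ∀ c : ℝ, c ≠ 0 → (g.restrict W) ⁻¹' {c} ∩ B = g ⁻¹' {c} ∩ (B ∩ W) := by
    intro c hc
    rw [SimpleFunc.restrict_preimage_singleton _ hW hc]
    ext x; simp only [Set.mem_inter_iff]; tauto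
  -- Extra values cost nothing, as their level sets are empty and `M ∅ = 0`; both sums can then run
  -- over one index set.
  have e : ∀ (k : SimpleFunc E ℝ) (D : Set E) (t : Finset ℝ), k.range ⊆ t →
      simpleIntegral M k D ω = ∑ c ∈ t, c * M (k ⁻¹' {c} ∩ D) ω := by
    intro k D t ht
    refine Finset.sum_subset ht fun c _ hc => ?_
    rw [SimpleFunc.preimage_eq_empty_iff k c |>.2 (by simpa using hc), Set.empty_inter, h0, mul_zero]
  rw [e (g.restrict W) B _ Finset.subset_union_left, e g (B ∩ W) _ Finset.subset_union_right]
  refine Finset.sum_congr rfl fun c _ => ?_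
  rcases eq_or_ne c 0 with rfl | hc
  · simp
  · rw [hset c hc]

end

/-! ### Gliding hump and limits of exponentials of integrals -/

section

variable {E : Type*} [MeasurableSpace E] {μ : Measure E}

/-- The derivative of `exp (-z)` has modulus at most 1 on the convex half-plane `0 ≤ re z`. -/
lemma norm_cexp_neg_sub_le {a b : ℂ} (ha : 0 ≤ a.re) (hb : 0 ≤ b.re) :
    ‖Complex.exp (-a) - Complex.exp (-b)‖ ≤ ‖a - b‖ := by
  have h := Convex.norm_image_sub_le_of_norm_hasDerivWithin_le (𝕜 := ℂ) (C := 1)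
    (f := fun z : ℂ => Complex.exp (-z)) (f' := fun z => Complex.exp (-z) * (-1))
    (s := {z : ℂ | 0 ≤ z.re}) (x := b) (y := a)
    (fun z _ => ((hasDerivAt_neg z).cexp).hasDerivWithinAt)
    (fun z hz => by
      rw [norm_mul, Complex.norm_exp, norm_neg, norm_one, mul_one, Real.exp_le_one_iff]
      simpa using hz)
    (convex_halfSpace_re_ge 0) hb ha
  simpa using h

/-- Gliding hump: if `exp (-∫_B φ k)` converges for every measurable `B` and `φ k → φ₀` in `L¹` on
each set of an exhausting sequence, then the limit over the whole space is `exp (-∫ φ₀)`. -/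
lemma tendsto_cexp_neg_integral_of_exhaustion {φ : ℕ → E → ℂ} {φ₀ : E → ℂ}
    (hφ : ∀ k, Integrable (φ k) μ) (hφ₀ : Integrable φ₀ μ)
    (hre : ∀ k x, 0 ≤ (φ k x).re) (hre₀ : ∀ x, 0 ≤ (φ₀ x).re)
    {S : ℕ → Set E} (hS : ∀ j, MeasurableSet (S j)) (hmono : Monotone S)
    (hcover : ∀ᵐ x ∂μ, ∃ j, x ∈ S j)
    (hlim : ∀ j, Tendsto (fun k => ∫ x in S j, ‖φ k x - φ₀ x‖ ∂μ) atTop (𝓝 0))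
    (hconv : ∀ B, MeasurableSet B →
      ∃ z, Tendsto (fun k => Complex.exp (-∫ x in B, φ k x ∂μ)) atTop (𝓝 z)) :
    Tendsto (fun k => Complex.exp (-∫ x, φ k x ∂μ)) atTop (𝓝 (Complex.exp (-∫ x, φ₀ x ∂μ))) := by
  obtain ⟨z, hz⟩ := hconv Set.univ MeasurableSet.univ
  simp only [Measure.restrict_univ] at hz
  have hw : ∀ k, Integrable (fun x => ‖φ k x - φ₀ x‖) μ := fun k => ((hφ k).sub hφ₀).norm
  suffices h : z = Complex.exp (-∫ x, φ₀ x ∂μ) by rwa [← h]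
  by_contra hne
  -- Two comparisons below cost `2 * ε` each, so the gap must exceed `4 * ε`.
  obtain ⟨ε, hε, hδ⟩ : ∃ ε : ℝ, 0 < ε ∧ 4 * ε < ‖z - Complex.exp (-∫ x, φ₀ x ∂μ)‖ :=
    ⟨‖z - Complex.exp (-∫ x, φ₀ x ∂μ)‖ / 5, by
      have := norm_pos_iff.2 (sub_ne_zero.2 hne); positivity, by
      have := norm_pos_iff.2 (sub_ne_zero.2 hne); linarith⟩
  have htail : ∀ k, Tendsto (fun j => ∫ x in (S j)ᶜ, ‖φ k x - φ₀ x‖ ∂μ) atTop (𝓝 0) := by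
    intro k
    have h0 : ∫ x in ⋂ j, (S j)ᶜ, ‖φ k x - φ₀ x‖ ∂μ = 0 := by
      rw [Measure.restrict_eq_zero.2, integral_zero_measure]
      refine measure_mono_null ?_ (ae_iff.1 hcover)
      intro x hx
      simpa using hx
    rw [← h0]
    exact tendsto_setIntegral_of_antitone (fun j => (hS j).compl)
      (fun i j hij => Set.compl_subset_compl.2 (hmono hij)) ⟨0, (hw k).integrableOn⟩
  have step : ∀ q : ℕ × ℕ, ∃ q' : ℕ × ℕ, q.1 < q'.1 ∧ q.2 ≤ q'.2 ∧
      ∫ x in S q.2, ‖φ q'.1 x - φ₀ x‖ ∂μ < ε ∧ ∫ x in (S q'.2)ᶜ, ‖φ q'.1 x - φ₀ x‖ ∂μ < ε := by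
    intro q
    obtain ⟨k, hk1, hk2⟩ :=
      (((hlim q.2).eventually (gt_mem_nhds hε)).and (eventually_gt_atTop q.1)).exists
    obtain ⟨j, hj1, hj2⟩ :=
      (((htail k).eventually (gt_mem_nhds hε)).and (eventually_ge_atTop q.2)).exists
    exact ⟨(k, j), hk2, hj2, hk1, hj1⟩
  choose N hN1 hN2 hN3 hN4 using step
  let q : ℕ → ℕ × ℕ := fun i => N^[i] (0, 0)
  have hq : ∀ i, q (i + 1) = N (q i) := fun i => Function.iterate_succ_apply' N i _
  -- By the choice of `N`, `φ (κ i)` is `ε`-close to `φ₀` in `L¹` both on `S (q i).2` and off `S (q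
  -- (i + 1)).2`; any larger discrepancy sits in the ring `R i` between them.
  let κ : ℕ → ℕ := fun i => (q (i + 1)).1
  have hκ : StrictMono κ := strictMono_nat_of_lt_succ fun i => by
    dsimp only [κ]; rw [hq (i + 1)]; exact hN1 _
  have hj : Monotone fun i => (q i).2 := monotone_nat_of_le_succ fun i => by
    rw [hq i]; exact hN2 _
  let R : ℕ → Set E := fun i => S (q (i + 1)).2 \ S (q i).2
  have hsmall : ∀ i C, Disjoint C (R i) →
      ∫ x in C, ‖φ (κ i) x - φ₀ x‖ ∂μ ≤ 2 * ε := by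
    intro i C hC
    have hsub : C ⊆ S (q i).2 ∪ (S (q (i + 1)).2)ᶜ := by
      intro x hx
      by_contra hx'
      simp only [Set.mem_union, Set.mem_compl_iff, not_or, not_not] at hx'
      exact Set.disjoint_left.1 hC hx ⟨hx'.2, hx'.1⟩
    have hdis : Disjoint (S (q i).2) (S (q (i + 1)).2)ᶜ :=
      Set.disjoint_compl_right_iff_subset.2 (hmono (hj i.le_succ))
    refine (setIntegral_mono_set (hw _).integrableOn (ae_of_all _ fun x => norm_nonneg _)
      hsub.eventuallyLE).trans ?_
    rw [setIntegral_union hdis (hS _).compl (hw _).integrableOn (hw _).integrableOn]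
    have h3 := hN3 (q i)
    have h4 := hN4 (q i)
    rw [← hq i] at h3 h4
    have h3' : ∫ x in S (q i).2, ‖φ (κ i) x - φ₀ x‖ ∂μ < ε := h3
    have h4' : ∫ x in (S (q (i + 1)).2)ᶜ, ‖φ (κ i) x - φ₀ x‖ ∂μ < ε := h4
    linarith
  have hRdisj : ∀ i l, i < l → Disjoint (R i) (R l) := by
    intro i l hil
    refine Set.disjoint_left.2 fun x hx hx' => hx'.2 (hmono (hj (Nat.succ_le_of_lt hil)) hx.1)
  let B : Set E := ⋃ i, R (2 * i)
  have hB : MeasurableSet B := MeasurableSet.iUnion fun i => (hS _).diff (hS _)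
  obtain ⟨z', hz'⟩ := hconv B hB
  -- The exponent is `φ k` on the even rings and `φ₀` elsewhere. Its exponential converges along all
  -- `k`, so the even and odd subsequences share one limit.
  have hF : Tendsto (fun k => Complex.exp (-(∫ x in B, φ k x ∂μ + ∫ x in Bᶜ, φ₀ x ∂μ))) atTop
      (𝓝 (z' * Complex.exp (-∫ x in Bᶜ, φ₀ x ∂μ))) :=
    (hz'.mul_const _).congr fun k => by rw [← Complex.exp_add]; congr 1; ring
  have hre_int : ∀ (g : E → ℂ), Integrable g μ → (∀ x, 0 ≤ (g x).re) → ∀ C : Set E,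
      0 ≤ (∫ x in C, g x ∂μ).re := by
    intro g hg hg0 C
    have : (∫ x in C, g x ∂μ).re = ∫ x in C, (g x).re ∂μ := (integral_re hg.integrableOn).symm
    rw [this]
    exact integral_nonneg hg0
  have hre_F : ∀ k, 0 ≤ (∫ x in B, φ k x ∂μ + ∫ x in Bᶜ, φ₀ x ∂μ).re := fun k => by
    rw [Complex.add_re]
    exact add_nonneg (hre_int _ (hφ k) (hre k) _) (hre_int _ hφ₀ hre₀ _)
  have hnorm : ∀ k C, ‖(∫ x in C, φ k x ∂μ) - ∫ x in C, φ₀ x ∂μ‖ ≤ ∫ x in C, ‖φ k x - φ₀ x‖ ∂μ := by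
    intro k C
    rw [← integral_sub (hφ k).integrableOn hφ₀.integrableOn]
    exact norm_integral_le_integral_norm _
  -- For even indices the hump lies in `B`, so replacing `φ₀` by `φ k` off `B` changes little and
  -- the limit is near `z`.
  have hev : ‖z' * Complex.exp (-∫ x in Bᶜ, φ₀ x ∂μ) - z‖ ≤ 2 * ε := by
    have hsub : Tendsto (fun i => κ (2 * i)) atTop atTop :=
      hκ.tendsto_atTop.comp (tendsto_id.const_mul_atTop' two_pos)
    refine le_of_tendsto ((hF.comp hsub).sub (hz.comp hsub)).norm (Eventually.of_forall fun i => ?_)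
    have h1 : ∫ x, φ (κ (2 * i)) x ∂μ
        = ∫ x in B, φ (κ (2 * i)) x ∂μ + ∫ x in Bᶜ, φ (κ (2 * i)) x ∂μ :=
      (integral_add_compl hB (hφ _)).symm
    have h2 := norm_cexp_neg_sub_le (hre_F (κ (2 * i)))
      (b := ∫ x, φ (κ (2 * i)) x ∂μ)
      (by simpa using hre_int _ (hφ (κ (2 * i))) (hre _) Set.univ)
    refine h2.trans ?_
    rw [h1, add_sub_add_left_eq_sub, norm_sub_rev]
    refine (hnorm _ _).trans (hsmall (2 * i) _ ?_)
    exact Set.disjoint_compl_left_iff_subset.2 (Set.subset_iUnion (fun i => R (2 * i)) i)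
  -- For odd indices the hump lies off `B`, so replacing `φ k` by `φ₀` on `B` changes little and the
  -- limit is near `exp (-∫ φ₀)`.
  have hod : ‖z' * Complex.exp (-∫ x in Bᶜ, φ₀ x ∂μ) - Complex.exp (-∫ x, φ₀ x ∂μ)‖ ≤ 2 * ε := by
    have hsub : Tendsto (fun i => κ (2 * i + 1)) atTop atTop :=
      hκ.tendsto_atTop.comp
        ((tendsto_add_atTop_nat 1).comp (tendsto_id.const_mul_atTop' two_pos))
    refine le_of_tendsto ((hF.comp hsub).sub_const _).norm (Eventually.of_forall fun i => ?_)
    have h1 : ∫ x, φ₀ x ∂μ = ∫ x in B, φ₀ x ∂μ + ∫ x in Bᶜ, φ₀ x ∂μ :=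
      (integral_add_compl hB hφ₀).symm
    have h2 := norm_cexp_neg_sub_le (hre_F (κ (2 * i + 1))) (b := ∫ x, φ₀ x ∂μ)
      (by simpa using hre_int _ hφ₀ hre₀ Set.univ)
    refine h2.trans ?_
    rw [h1, add_sub_add_right_eq_sub]
    refine (hnorm _ _).trans (hsmall (2 * i + 1) _ ?_)
    refine Set.disjoint_iUnion_left.2 fun l => ?_
    rcases lt_or_gt_of_ne (show 2 * l ≠ 2 * i + 1 by omega) with h | h
    · exact hRdisj _ _ h
    · exact (hRdisj _ _ h).symm
  have htri := norm_sub_le_norm_sub_add_norm_sub z (z' * Complex.exp (-∫ x in Bᶜ, φ₀ x ∂μ))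
    (Complex.exp (-∫ x, φ₀ x ∂μ))
  rw [norm_sub_rev z (z' * _)] at htri
  linarith

/-- An Egorov-type exhaustion reduces to the previous lemma: on `S j` the differences are bounded by
1 from index `j` on and are carried by a set of finite measure, so dominated convergence applies. -/
lemma tendsto_cexp_neg_integral {φ : ℕ → E → ℂ} {φ₀ : E → ℂ}
    (hφm : ∀ k, Measurable (φ k)) (hφ₀m : Measurable φ₀)
    (hφ : ∀ k, Integrable (φ k) μ) (hφ₀ : Integrable φ₀ μ)
    (hre : ∀ k x, 0 ≤ (φ k x).re) (hre₀ : ∀ x, 0 ≤ (φ₀ x).re)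
    {T : ℕ → Set E} (hT : ∀ j, MeasurableSet (T j)) (hTfin : ∀ j, μ (T j) < ∞)
    (hφT : ∀ k, ∀ x ∉ T k, φ k x = 0)
    (hlim : ∀ᵐ x ∂μ, Tendsto (fun k => φ k x) atTop (𝓝 (φ₀ x)))
    (hconv : ∀ B, MeasurableSet B →
      ∃ z, Tendsto (fun k => Complex.exp (-∫ x in B, φ k x ∂μ)) atTop (𝓝 z)) :
    Tendsto (fun k => Complex.exp (-∫ x, φ k x ∂μ)) atTop (𝓝 (Complex.exp (-∫ x, φ₀ x ∂μ))) := by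
  set U : ℕ → Set E := fun j => ⋃ i ∈ Finset.range j, T i with hUdef
  -- All `φ k` vanish on `V`, hence so does `φ₀` almost everywhere; `V` may have infinite measure
  -- but contributes nothing.
  set V : Set E := (⋃ i, T i)ᶜ with hVdef
  have hU : ∀ j, MeasurableSet (U j) := fun j => Finset.measurableSet_biUnion _ fun i _ => hT i
  have hUfin : ∀ j, μ (U j) < ∞ := fun j =>
    measure_biUnion_lt_top (Finset.finite_toSet _) fun i _ => hTfin i
  have hV : MeasurableSet V := (MeasurableSet.iUnion hT).compl
  set S : ℕ → Set E := fun j => (U j ∪ V) ∩ ⋂ k, ⋂ (_ : j ≤ k), {x | ‖φ k x - φ₀ x‖ ≤ 1} with hSdef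
  have hS : ∀ j, MeasurableSet (S j) := fun j => ((hU j).union hV).inter
    (MeasurableSet.iInter fun k => MeasurableSet.iInter fun _ =>
      measurableSet_le ((hφm k).sub hφ₀m).norm measurable_const)
  have hφ₀V : ∀ᵐ x ∂μ, x ∈ V → φ₀ x = 0 := by
    filter_upwards [hlim] with x hx hxV
    refine tendsto_nhds_unique hx (tendsto_const_nhds.congr fun k => (hφT k x ?_).symm)
    exact fun h => hxV (Set.mem_iUnion.2 ⟨k, h⟩)
  have hUmono : Monotone U := fun i j hij =>
    Set.biUnion_subset_biUnion_left fun a ha => by simp at ha ⊢; omega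
  refine tendsto_cexp_neg_integral_of_exhaustion hφ hφ₀ hre hre₀ hS ?_ ?_ ?_ hconv
  · intro i j hij x hx
    refine ⟨hx.1.imp (fun h => hUmono hij h) id, ?_⟩
    simp only [Set.mem_iInter] at hx ⊢
    exact fun k hk => (Set.mem_iInter₂.1 hx.2) k (hij.trans hk)
  · filter_upwards [hlim] with x hx
    have h1 : Tendsto (fun k => ‖φ k x - φ₀ x‖) atTop (𝓝 0) :=
      tendsto_iff_norm_sub_tendsto_zero.1 hx
    obtain ⟨K, hK⟩ := eventually_atTop.1 (h1.eventually (ge_mem_nhds one_pos))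
    by_cases hxV : x ∈ V
    · exact ⟨K, Or.inr hxV, Set.mem_iInter₂.2 fun k hk => hK k hk⟩
    · obtain ⟨i, hi⟩ := Set.mem_iUnion.1 (not_not.1 hxV)
      refine ⟨max K (i + 1), Or.inl ?_, Set.mem_iInter₂.2 fun k hk => hK k (le_of_max_le_left hk)⟩
      refine Set.mem_biUnion (x := i) ?_ hi
      simp
  · intro j
    have h0 : (0 : ℝ) = ∫ x in S j, (0 : ℝ) ∂μ := by simp
    rw [h0]
    refine tendsto_integral_filter_of_dominated_convergence (Set.indicator (U j) fun _ => (1 : ℝ))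
      (Eventually.of_forall fun k => (((hφm k).sub hφ₀m).norm).aestronglyMeasurable) ?_ ?_ ?_
    · filter_upwards [eventually_ge_atTop j] with k hk
      filter_upwards [ae_restrict_of_ae hφ₀V, ae_restrict_mem (hS j)] with x h1 h2
      by_cases hxU : x ∈ U j
      · rw [Set.indicator_of_mem hxU, norm_norm]
        exact Set.mem_iInter₂.1 h2.2 k hk
      · have hxV : x ∈ V := h2.1.resolve_left hxU
        have hxT : x ∉ T k := fun h => hxV (Set.mem_iUnion.2 ⟨k, h⟩)
        rw [Set.indicator_of_notMem hxU, h1 hxV, hφT k x hxT]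
        simp
    · exact ((integrable_indicator_iff (hU j)).2
        (integrableOn_const (hUfin j).ne)).restrict
    · filter_upwards [ae_restrict_of_ae hlim] with x hx
      exact tendsto_iff_norm_sub_tendsto_zero.1 hx

end

/-! ### Convergence in probability and characteristic functions -/

section

variable {Ω : Type*} [MeasurableSpace Ω] {P : Measure Ω}

lemma TendstoInMeasure.sub {f g : ℕ → Ω → ℝ} {F G : Ω → ℝ} (hf : TendstoInMeasure P f atTop F)
    (hg : TendstoInMeasure P g atTop G) :
    TendstoInMeasure P (fun n ω => f n ω - g n ω) atTop (fun ω => F ω - G ω) := by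
  rw [tendstoInMeasure_iff_norm] at *
  intro ε hε
  have h := (hf (ε / 2) (half_pos hε)).add (hg (ε / 2) (half_pos hε))
  rw [add_zero] at h
  refine tendsto_of_tendsto_of_tendsto_of_le_of_le tendsto_const_nhds h (fun _ => zero_le)
    fun n => (measure_mono fun ω hω => ?_).trans (measure_union_le _ _)
  by_contra hcon
  simp only [Set.mem_union, Set.mem_ofPred_eq, not_or, not_le] at hcon hω
  have := norm_sub_le (f n ω - F ω) (g n ω - G ω)
  rw [show f n ω - F ω - (g n ω - G ω) = f n ω - g n ω - (F ω - G ω) by ring] at this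
  linarith

lemma tendstoInMeasure_pi {k : ℕ} {f : ℕ → Fin k → Ω → ℝ} {F : Fin k → Ω → ℝ}
    (h : ∀ j, TendstoInMeasure P (fun n => f n j) atTop (F j)) :
    TendstoInMeasure P (fun n ω j => f n j ω) atTop (fun ω j => F j ω) := by
  intro ε hε
  have hsum : Tendsto (fun n => ∑ j, P {ω | ε ≤ edist (f n j ω) (F j ω)}) atTop (𝓝 0) := by
    simpa using tendsto_finsetSum Finset.univ fun j _ => h j ε hε
  refine tendsto_of_tendsto_of_tendsto_of_le_of_le tendsto_const_nhds hsum (fun _ => zero_le)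
    fun n => (measure_mono fun ω hω => ?_).trans (measure_iUnion_fintype_le P _)
  by_contra hcon
  simp only [Set.mem_iUnion, Set.mem_ofPred_eq, not_exists, not_le] at hcon hω
  refine absurd hω (not_le.2 ?_)
  rw [edist_pi_def, Finset.sup_lt_iff hε]
  exact fun j _ => hcon j

lemma tendsto_charFun_of_tendstoInMeasure [IsProbabilityMeasure P] {Y : ℕ → Ω → ℝ} {Z : Ω → ℝ}
    (hY : ∀ n, AEMeasurable (Y n) P) (h : TendstoInMeasure P Y atTop Z) (θ : ℝ) :
    Tendsto (fun n => charFun (P.map (Y n)) θ) atTop (𝓝 (charFun (P.map Z) θ)) :=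
  ProbabilityMeasure.tendsto_iff_tendsto_charFun.1 (h.tendstoInDistribution hY).tendsto θ

lemma tendstoInMeasure_zero_of_tendsto_charFun [IsProbabilityMeasure P] {D : ℕ → Ω → ℝ}
    (hD : ∀ n, AEMeasurable (D n) P)
    (h : ∀ θ, Tendsto (fun n => charFun (P.map (D n)) θ) atTop (𝓝 1)) :
    TendstoInMeasure P D atTop 0 := by
  rw [tendstoInMeasure_iff_measureReal_norm]
  intro ε hε
  have hp : ∀ n, IsProbabilityMeasure (P.map (D n)) := fun n => Measure.isProbabilityMeasure_map (hD n)
  -- The tail bound used below controls `|D n| > ε / 2`, an event containing `ε ≤ |D n|`, by the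
  -- integral of `1 - charFun` over this interval.
  have hint : Tendsto (fun n => ∫ t in (-2 * (ε / 2)⁻¹)..(2 * (ε / 2)⁻¹), 1 - charFun (P.map (D n)) t)
      atTop (𝓝 (∫ _ in (-2 * (ε / 2)⁻¹)..(2 * (ε / 2)⁻¹), (0 : ℂ))) := by
    refine intervalIntegral.tendsto_integral_filter_of_dominated_convergence (fun _ => 2)
      (Eventually.of_forall fun n => ?_) (Eventually.of_forall fun n => ?_)
      intervalIntegrable_const ?_
    · exact (measurable_const.sub measurable_charFun).aestronglyMeasurable
    · exact ae_of_all _ fun t _ => norm_one_sub_charFun_le_two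
    · refine ae_of_all _ fun t _ => ?_
      simpa using (h t).const_sub 1
  rw [intervalIntegral.integral_zero] at hint
  have hb := (hint.norm.const_mul (2⁻¹ * (ε / 2)))
  rw [norm_zero, mul_zero] at hb
  refine squeeze_zero (fun _ => measureReal_nonneg) (fun n => ?_) hb
  refine le_trans ?_ (measureReal_abs_gt_le_integral_charFun (μ := P.map (D n)) (half_pos hε))
  rw [map_measureReal_apply_of_aemeasurable (hD n)
    (measurableSet_lt measurable_const continuous_abs.measurable)]
  refine measureReal_mono fun ω hω => ?_
  have : ε ≤ |D n ω| := by simpa using hω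
  simp only [Set.mem_preimage, Set.mem_ofPred_eq]
  linarith

end

/-! ### Stochastic integrals and their characteristic functions -/

section

variable {Ω E : Type*} [MeasurableSpace Ω] [MeasurableSpace E] {P : Measure Ω} {α : ℝ}
  {m : Measure E} {β : E → ℝ} {M : Set E → Ω → ℝ}

namespace IsStochasticIntegral

lemma aemeasurable (hM : IsStableRandomMeasure P α m β M) {f : E → ℝ} {D : Set E}
    (hD : MeasurableSet D) {Y : Ω → ℝ} (h : IsStochasticIntegral P m M f D Y) :
    AEMeasurable Y P := by
  obtain ⟨g, hg, -, -, hY⟩ := h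
  exact hY.aemeasurable fun n => aemeasurable_simpleIntegral hM (hg n) hD

/-- Restricting the approximants to `D` turns convergence over `B` into convergence over `B ∩ D`, so
only integrals over the whole space need a characteristic function. -/
lemma indicator (hM : IsStableRandomMeasure P α m β M) {f : E → ℝ} {D : Set E}
    (hD : MeasurableSet D) {Y : Ω → ℝ} (h : IsStochasticIntegral P m M f D Y) :
    IsStochasticIntegral P m M (D.indicator f) Set.univ Y := by
  obtain ⟨g, hg, hlim, hconv, hY⟩ := h
  refine ⟨fun k => (g k).restrict D, fun k => ?_, ?_, fun B hB => ?_, ?_⟩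
  · rw [SimpleFunc.finMeasSupp_iff]
    intro c hc
    rw [SimpleFunc.restrict_preimage_singleton _ hD hc]
    exact (measure_mono Set.inter_subset_right).trans_lt ((hg k).meas_preimage_singleton_ne_zero hc)
  · filter_upwards [hlim] with x hx
    simp only [SimpleFunc.restrict_apply _ hD]
    by_cases hxD : x ∈ D
    · simpa [hxD] using hx
    · simp [hxD]
  · obtain ⟨Z, hZ⟩ := hconv (B ∩ D) (hB.inter hD)
    exact ⟨Z, hZ.congr_left fun k => (simpleIntegral_restrict hM (g k) hD B).symm⟩
  · refine hY.congr_left fun k => ?_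
    have := simpleIntegral_restrict hM (g k) hD Set.univ
    rw [Set.univ_inter] at this
    exact this.symm

lemma sub (hM : IsStableRandomMeasure P α m β M) {f f' : E → ℝ} {D : Set E}
    (hD : MeasurableSet D) {Y Y' : Ω → ℝ} (h : IsStochasticIntegral P m M f D Y)
    (h' : IsStochasticIntegral P m M f' D Y') :
    IsStochasticIntegral P m M (fun x => f x - f' x) D (fun ω => Y ω - Y' ω) := by
  obtain ⟨g, hg, hlim, hconv, hY⟩ := h
  obtain ⟨g', hg', hlim', hconv', hY'⟩ := h'
  refine ⟨fun k => g k - g' k, fun k => ?_, ?_, fun B hB => ?_, ?_⟩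
  · have e : g k - g' k = ((g k).pair (g' k)).map fun c => c.1 - c.2 := rfl
    dsimp only
    rw [e]
    exact ((hg k).pair (hg' k)).map (sub_zero 0)
  · filter_upwards [hlim, hlim'] with x hx hx'
    exact hx.sub hx'
  · obtain ⟨Z, hZ⟩ := hconv B hB
    obtain ⟨Z', hZ'⟩ := hconv' B hB
    exact ⟨_, (TendstoInMeasure.sub hZ hZ').congr_left
      fun k => (simpleIntegral_sub hM (hg k) (hg' k) hB).symm⟩
  · exact (TendstoInMeasure.sub hY hY').congr_left
      fun k => (simpleIntegral_sub hM (hg k) (hg' k) hD).symm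

/-- The characteristic function of a stochastic integral with respect to a stable random
measure. -/
theorem charFun_eq [IsProbabilityMeasure P] (hM : IsStableRandomMeasure P α m β M) (hα : 0 < α)
    {f : E → ℝ} {Y : Ω → ℝ} (h : IsStochasticIntegral P m M f Set.univ Y) (θ : ℝ)
    (hint : Integrable (fun x => stableExponent α (β x) (θ * f x)) m) :
    charFun (P.map Y) θ = Complex.exp (-∫ x, stableExponent α (β x) (θ * f x) ∂m) := by
  obtain ⟨g, hg, hlim, hconv, hY⟩ := h
  -- The gliding hump requires a measurable limit, hence the passage to `hf.mk f`.
  have hf : AEMeasurable f m :=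
    aemeasurable_of_tendsto_metrizable_ae atTop (fun k => (g k).measurable.aemeasurable) hlim
  have hcf : ∀ k B, MeasurableSet B → charFun (P.map (simpleIntegral M (g k) B)) θ =
      Complex.exp (-∫ x in B, stableExponent α (β x) (θ * g k x) ∂m) :=
    fun k B hB => charFun_simpleIntegral hM hα (hg k) hB θ
  have heq : (fun x => stableExponent α (β x) (θ * f x)) =ᵐ[m]
      fun x => stableExponent α (β x) (θ * hf.mk f x) := by
    filter_upwards [hf.ae_eq_mk] with x hx
    rw [hx]
  have hlim₀ : ∀ᵐ x ∂m, Tendsto (fun k => stableExponent α (β x) (θ * g k x)) atTop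
      (𝓝 (stableExponent α (β x) (θ * hf.mk f x))) := by
    filter_upwards [hlim, hf.ae_eq_mk] with x hx hx'
    rw [← hx']
    have hc : Continuous fun u => stableExponent α (β x) (θ * u) :=
      (continuous_stableExponent hα).comp (continuous_const.prodMk (continuous_const_mul θ))
    exact (hc.tendsto _).comp hx
  have hconv₀ : ∀ B, MeasurableSet B → ∃ z, Tendsto
      (fun k => Complex.exp (-∫ x in B, stableExponent α (β x) (θ * g k x) ∂m)) atTop (𝓝 z) := by
    intro B hB
    obtain ⟨Z, hZ⟩ := hconv B hB
    have h1 := tendsto_charFun_of_tendstoInMeasure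
      (fun k => aemeasurable_simpleIntegral hM (hg k) hB) hZ θ
    simp only [hcf _ B hB] at h1
    exact ⟨_, h1⟩
  have key := tendsto_cexp_neg_integral (T := fun k => Function.support (g k))
    (fun k => hM.measurable_stableExponent hα ((g k).measurable.const_mul θ))
    (hM.measurable_stableExponent hα (hf.measurable_mk.const_mul θ))
    (fun k => hM.integrable_stableExponent hα (hg k) θ) (hint.congr heq)
    (fun _ _ => stableExponent_re_nonneg) (fun _ => stableExponent_re_nonneg)
    (fun k => (g k).measurableSet_support)
    (fun k => SimpleFunc.finMeasSupp_iff_support.1 (hg k))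
    (fun k x hx => by
      rw [Function.notMem_support.1 hx, mul_zero, stableExponent_zero hα]) hlim₀ hconv₀
  have hY₀ := tendsto_charFun_of_tendstoInMeasure
    (fun k => aemeasurable_simpleIntegral hM (hg k) MeasurableSet.univ) hY θ
  simp only [hcf _ _ MeasurableSet.univ, Measure.restrict_univ] at hY₀
  rw [integral_congr_ae heq]
  exact tendsto_nhds_unique hY₀ key

end IsStochasticIntegral

end

/-! ### Control of the exponent by the error, and the conclusion -/

section

/-- Apply `log x ≤ x ^ ε / ε` with `ε = 1 / 2` to `|u|` and to its inverse. -/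
lemma abs_mul_log_le (u : ℝ) :
    |u * Real.log u| ≤ 2 * (|u| ^ (1 / 2 : ℝ) + |u| ^ (3 / 2 : ℝ)) := by
  rcases eq_or_ne u 0 with rfl | hu
  · simp
  have hu' : 0 < |u| := abs_pos.2 hu
  have h1 := Real.log_le_rpow_div hu'.le (ε := 1 / 2) (by norm_num)
  have h2 := Real.log_le_rpow_div (inv_pos.2 hu').le (ε := 1 / 2) (by norm_num)
  rw [Real.log_inv] at h2
  have e1 : |u| ^ (3 / 2 : ℝ) = |u| * |u| ^ (1 / 2 : ℝ) := by
    rw [show (3 / 2 : ℝ) = 1 + 1 / 2 by norm_num, Real.rpow_add hu', Real.rpow_one]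
  have e2 : |u| ^ (1 / 2 : ℝ) = |u| * |u|⁻¹ ^ (1 / 2 : ℝ) := by
    rw [Real.inv_rpow hu'.le, ← Real.rpow_neg hu'.le]
    nth_rewrite 2 [← Real.rpow_one |u|]
    rw [← Real.rpow_add hu']
    norm_num
  have p1 : 0 ≤ |u| ^ (1 / 2 : ℝ) := by positivity
  have p2 : 0 ≤ |u|⁻¹ ^ (1 / 2 : ℝ) := by positivity
  have hlog : |Real.log u| ≤ 2 * (|u|⁻¹ ^ (1 / 2 : ℝ) + |u| ^ (1 / 2 : ℝ)) := by
    rw [← Real.log_abs, abs_le]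
    constructor <;> linarith
  rw [abs_mul, e1]
  refine (mul_le_mul_of_nonneg_left hlog hu'.le).trans (le_of_eq ?_)
  linear_combination (-2) * e2

lemma norm_stableExponent_one_le {b u : ℝ} (hb : |b| ≤ 1) :
    ‖stableExponent 1 b u‖ ≤ 3 * (|u| ^ (1 / 2 : ℝ) + |u| ^ (3 / 2 : ℝ)) := by
  have h1 : |u| ≤ |u| ^ (1 / 2 : ℝ) + |u| ^ (3 / 2 : ℝ) := by
    rcases le_total |u| 1 with h | h
    · have := Real.rpow_le_rpow_of_exponent_ge' (abs_nonneg u) h (by norm_num)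
        (show (1 / 2 : ℝ) ≤ 1 by norm_num)
      rw [Real.rpow_one] at this
      have : 0 ≤ |u| ^ (3 / 2 : ℝ) := by positivity
      linarith
    · have := Real.rpow_le_rpow_of_exponent_le h (show (1 : ℝ) ≤ 3 / 2 by norm_num)
      rw [Real.rpow_one] at this
      have : 0 ≤ |u| ^ (1 / 2 : ℝ) := by positivity
      linarith
  have h2 : |skewPart 1 u| ≤ |u * Real.log u| := by
    rw [skewPart, if_pos rfl, abs_mul, abs_of_pos (by positivity : 0 < 2 / Real.pi)]
    exact mul_le_of_le_one_left (abs_nonneg _) ((div_le_one Real.pi_pos).2 Real.two_le_pi)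
  have h3 := norm_stableExponent_le (α := 1) (b := b) (u := u)
  have h4 := mul_le_mul hb h2 (abs_nonneg _) zero_le_one
  have h5 := abs_mul_log_le u
  rw [Real.rpow_one] at h3
  linarith

lemma norm_stableExponent_le_of_ne_one {α b u : ℝ} (hα : α ≠ 1) (hb : |b| ≤ 1) :
    ‖stableExponent α b u‖ ≤ (1 + |Real.tan (Real.pi * α / 2)|) * |u| ^ α := by
  have hp : 0 ≤ |u| ^ α := by positivity
  have h2 : |skewPart α u| ≤ |Real.tan (Real.pi * α / 2)| * |u| ^ α := by
    rw [skewPart, if_neg hα, abs_neg, abs_mul, abs_mul, abs_of_nonneg hp]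
    refine mul_le_mul_of_nonneg_left (mul_le_of_le_one_left hp ?_) (abs_nonneg _)
    rcases Real.sign_apply_eq u with h | h | h <;> simp [h]
  have h3 := norm_stableExponent_le (α := α) (b := b) (u := u)
  have h4 := mul_le_mul hb h2 (abs_nonneg _) zero_le_one
  linarith

variable {Ω E : Type*} [MeasurableSpace Ω] [MeasurableSpace E] {P : Measure Ω} {α : ℝ}
  {m : Measure E} {β : E → ℝ} {M : Set E → Ω → ℝ} {W : Set E}

lemma ofReal_abs_rpow (s : ℝ) (hs : 0 ≤ s) (u : ℝ) : ENNReal.ofReal (|u| ^ s) = ‖u‖ₑ ^ s := by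
  rw [← ENNReal.ofReal_rpow_of_nonneg (abs_nonneg u) hs, Real.enorm_eq_ofReal_abs]

lemma kernelErr_eq_eLpNorm' {s : ℝ} (hs : 0 ≤ s) (f g : E → ℝ) :
    kernelErr m W s f g = eLpNorm' (fun x => f x - g x) s (m.restrict W) := by
  simp only [kernelErr, eLpNorm', ofReal_abs_rpow s hs]

lemma tendsto_lintegral_of_tendsto_eLpNorm' {μ : Measure E} {s : ℝ} (hs : 0 < s) {h : ℕ → E → ℝ}
    (hlim : Tendsto (fun n => eLpNorm' (h n) s μ) atTop (𝓝 0)) :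
    Tendsto (fun n => ∫⁻ x, ‖h n x‖ₑ ^ s ∂μ) atTop (𝓝 0) := by
  have h1 := ((ENNReal.continuous_rpow_const (y := s)).tendsto 0).comp hlim
  rw [ENNReal.zero_rpow_of_pos hs] at h1
  refine h1.congr fun n => ?_
  simp only [Function.comp_apply, eLpNorm']
  rw [← ENNReal.rpow_mul, one_div_mul_cancel hs.ne', ENNReal.rpow_one]

lemma tendsto_lintegral_stableExponent_of_norm_le {s C : ℝ} (hs : 0 < s)
    {h : ℕ → E → ℝ} (hC : ∀ᵐ x ∂m, ∀ u, ‖stableExponent α (β x) u‖ ≤ C * |u| ^ s)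
    (hlim : Tendsto (fun n => ∫⁻ x, ‖h n x‖ₑ ^ s ∂m) atTop (𝓝 0)) (θ : ℝ) :
    Tendsto (fun n => ∫⁻ x, ‖stableExponent α (β x) (θ * h n x)‖ₑ ∂m) atTop (𝓝 0) := by
  have h0 := ENNReal.Tendsto.const_mul (a := ENNReal.ofReal (C * |θ| ^ s)) hlim
    (Or.inr ENNReal.ofReal_ne_top)
  rw [mul_zero] at h0
  refine tendsto_of_tendsto_of_tendsto_of_le_of_le tendsto_const_nhds h0 (fun _ => zero_le)
    fun n => ?_
  dsimp only
  rw [← lintegral_const_mul' _ _ ENNReal.ofReal_ne_top]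
  refine lintegral_mono_ae ?_
  filter_upwards [hC] with x hx
  rw [← ofReal_abs_rpow s hs.le, ← ENNReal.ofReal_mul' (by positivity), ← ofReal_norm]
  refine ENNReal.ofReal_le_ofReal ((hx _).trans (le_of_eq ?_))
  rw [abs_mul, Real.mul_rpow (abs_nonneg _) (abs_nonneg _)]
  ring

lemma tendsto_lintegral_stableExponent_one (hβ : ∀ x, |β x| ≤ 1) [IsFiniteMeasure m]
    {h : ℕ → E → ℝ} (hm : ∀ n, AEMeasurable (h n) m)
    (hlim : Tendsto (fun n => eLpNorm' (h n) (3 / 2) m) atTop (𝓝 0)) (θ : ℝ) :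
    Tendsto (fun n => ∫⁻ x, ‖stableExponent 1 (β x) (θ * h n x)‖ₑ ∂m) atTop (𝓝 0) := by
  -- By Hölder's inequality on a finite measure, the `3 / 2` error controls the `1 / 2` error; this
  -- is where `m W < ∞` enters.
  have hlim' : Tendsto (fun n => eLpNorm' (h n) (1 / 2) m) atTop (𝓝 0) := by
    have hb := ENNReal.Tendsto.mul_const (b := m Set.univ ^ (1 / (1 / 2 : ℝ) - 1 / (3 / 2 : ℝ)))
      hlim (Or.inr (ENNReal.rpow_ne_top_of_nonneg (by norm_num) (measure_ne_top _ _)))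
    rw [zero_mul] at hb
    exact tendsto_of_tendsto_of_tendsto_of_le_of_le tendsto_const_nhds hb (fun _ => zero_le)
      fun n => eLpNorm'_le_eLpNorm'_mul_rpow_measure_univ (by norm_num) (by norm_num)
        (hm n).aestronglyMeasurable
  have L1 := tendsto_lintegral_of_tendsto_eLpNorm' (by norm_num) hlim'
  have L2 := tendsto_lintegral_of_tendsto_eLpNorm' (by norm_num) hlim
  have h0 := (ENNReal.Tendsto.const_mul (a := ENNReal.ofReal (3 * |θ| ^ (1 / 2 : ℝ))) L1
    (Or.inr ENNReal.ofReal_ne_top)).add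
    (ENNReal.Tendsto.const_mul (a := ENNReal.ofReal (3 * |θ| ^ (3 / 2 : ℝ))) L2
    (Or.inr ENNReal.ofReal_ne_top))
  rw [mul_zero, mul_zero, add_zero] at h0
  refine tendsto_of_tendsto_of_tendsto_of_le_of_le tendsto_const_nhds h0 (fun _ => zero_le)
    fun n => ?_
  dsimp only
  rw [← lintegral_const_mul' _ _ ENNReal.ofReal_ne_top,
    ← lintegral_const_mul' _ _ ENNReal.ofReal_ne_top,
    ← lintegral_add_left' (((hm n).enorm.pow_const _).const_mul _)]
  refine lintegral_mono fun x => ?_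
  rw [← ofReal_abs_rpow _ (by norm_num), ← ofReal_abs_rpow _ (by norm_num),
    ← ENNReal.ofReal_mul' (by positivity), ← ENNReal.ofReal_mul' (by positivity),
    ← ENNReal.ofReal_add (by positivity) (by positivity), ← ofReal_norm]
  refine ENNReal.ofReal_le_ofReal ((norm_stableExponent_one_le (hβ x)).trans (le_of_eq ?_))
  rw [abs_mul, Real.mul_rpow (abs_nonneg _) (abs_nonneg _),
    Real.mul_rpow (abs_nonneg _) (abs_nonneg _)]
  ring

lemma tendsto_lintegral_stableExponent_of_kernelErr (hα : 0 < α) (hβ : ∀ x, |β x| ≤ 1)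
    (hW : α = 1 → m W < ∞) {s : ℝ} (hs : IsErrExponent α m W β s)
    {f : E → ℝ} {f' : ℕ → E → ℝ} (hm : ∀ n, AEMeasurable (fun x => f x - f' n x) m)
    (hErr : Tendsto (fun n => kernelErr m W s f (f' n)) atTop (𝓝 0)) (θ : ℝ) :
    Tendsto (fun n => ∫⁻ x in W, ‖stableExponent α (β x) (θ * (f x - f' n x))‖ₑ ∂m) atTop
      (𝓝 0) := by
  rcases hs with ⟨rfl, hs⟩ | ⟨rfl, rfl⟩
  · simp only [kernelErr_eq_eLpNorm' hα.le] at hErr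
    refine tendsto_lintegral_stableExponent_of_norm_le
      (C := 1 + |Real.tan (Real.pi * s / 2)|) hα ?_
      (tendsto_lintegral_of_tendsto_eLpNorm' hα hErr) θ
    rcases hs with hs | hs
    · exact ae_of_all _ fun x u => norm_stableExponent_le_of_ne_one hs (hβ x)
    -- With zero skewness the logarithmic or tangent term disappears and only `|u| ^ s` remains.
    · filter_upwards [hs] with x hx u
      refine norm_stableExponent_le.trans ?_
      have : 0 ≤ |Real.tan (Real.pi * s / 2)| * |u| ^ s := by positivity
      rw [hx, abs_zero, zero_mul]
      linarith
  · simp only [kernelErr_eq_eLpNorm' (show (0 : ℝ) ≤ 3 / 2 by norm_num)] at hErr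
    have : IsFiniteMeasure (m.restrict W) := ⟨by simpa using hW rfl⟩
    exact tendsto_lintegral_stableExponent_one hβ (fun n => (hm n).restrict) hErr θ

theorem tendstoInMeasure_stochasticIntegral [IsProbabilityMeasure P]
    (hM : IsStableRandomMeasure P α m β M) (hα : 0 < α) (hWm : MeasurableSet W)
    (hW : α = 1 → m W < ∞) {s : ℝ} (hs : IsErrExponent α m W β s) {f : E → ℝ} {f' : ℕ → E → ℝ}
    (hf : AEMeasurable f m) (hf' : ∀ n, AEMeasurable (f' n) m) (hsupp : Function.support f ⊆ W)
    {X : Ω → ℝ} {X' : ℕ → Ω → ℝ} (hX : IsStochasticIntegral P m M f Set.univ X)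
    (hX' : ∀ n, IsStochasticIntegral P m M (f' n) W (X' n))
    (hErr : Tendsto (fun n => kernelErr m W s f (f' n)) atTop (𝓝 0)) :
    TendstoInMeasure P X' atTop X := by
  have hD : ∀ n, IsStochasticIntegral P m M (fun x => f x - W.indicator (f' n) x) Set.univ
      (fun ω => X ω - X' n ω) :=
    fun n => hX.sub hM MeasurableSet.univ ((hX' n).indicator hM hWm)
  -- Off `W` both kernels are 0 and the exponent vanishes at 0, so only the error on `W` matters.
  have hind : ∀ θ n, (fun x => stableExponent α (β x) (θ * (f x - W.indicator (f' n) x))) =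
      W.indicator fun x => stableExponent α (β x) (θ * (f x - f' n x)) := by
    intro θ n
    funext x
    by_cases hx : x ∈ W
    · simp [hx]
    · have : f x = 0 := by
        by_contra h
        exact hx (hsupp h)
      simp [hx, this, stableExponent_zero hα]
  have hlim := tendsto_lintegral_stableExponent_of_kernelErr hα hM.abs_skewness_le hW hs
    (fun n => hf.sub (hf' n)) hErr
  have hch : ∀ θ, Tendsto (fun n => charFun (P.map fun ω => X ω - X' n ω) θ) atTop (𝓝 1) := by
    intro θ
    have hI : Tendsto
        (fun n => ∫ x in W, stableExponent α (β x) (θ * (f x - f' n x)) ∂m) atTop (𝓝 0) := by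
      have ht := (ENNReal.tendsto_toReal ENNReal.zero_ne_top).comp (hlim θ)
      refine squeeze_zero_norm' ?_ ht
      filter_upwards [(hlim θ).eventually (gt_mem_nhds ENNReal.zero_lt_top)] with n hn
      exact toReal_enorm (E := ℂ) _ ▸ ENNReal.toReal_mono hn.ne (enorm_integral_le_lintegral_enorm _)
    have hE := (Complex.continuous_exp.tendsto _).comp hI.neg
    rw [neg_zero, Complex.exp_zero] at hE
    refine hE.congr' ?_
    filter_upwards [(hlim θ).eventually (gt_mem_nhds ENNReal.zero_lt_top)] with n hn
    -- Integrability of the exponent comes from the convergence `hlim θ`, which makes its `L¹` norm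
    -- finite for large `n`.
    have hint : IntegrableOn (fun x => stableExponent α (β x) (θ * (f x - f' n x))) W m :=
      ⟨((continuous_stableExponent hα).measurable.comp_aemeasurable
        (hM.measurable_skewness.aemeasurable.prodMk
          ((hf.sub (hf' n)).const_mul θ))).aestronglyMeasurable.restrict, hn⟩
    rw [(hD n).charFun_eq hM hα θ (by rw [hind]; exact hint.integrable_indicator hWm), hind,
      integral_indicator hWm]
    rfl
  have hX'X := tendstoInMeasure_zero_of_tendsto_charFun
    (fun n => (hD n).aemeasurable hM MeasurableSet.univ) hch
  rw [tendstoInMeasure_iff_norm] at hX'X ⊢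
  intro ε hε
  refine (hX'X ε hε).congr fun n => ?_
  simp only [Pi.zero_apply, sub_zero, norm_sub_rev (X _)]

end

end StableField

end

theorem mainTheorem6
    {Ω : Type*} [MeasurableSpace Ω] (P : Measure Ω) [IsProbabilityMeasure P]
    (d q : ℕ) (α T A : ℝ) (hα : 0 < α) (hα' : α ≤ 2) (hT : 0 < T) (hA : 0 < A)
    (m : Measure (Fin d → ℝ)) (hm : α = 1 → m (StableField.cube d A) < ∞)
    (β : (Fin d → ℝ) → ℝ) (M : Set (Fin d → ℝ) → Ω → ℝ)
    (hM : StableField.IsStableRandomMeasure P α m β M)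
    (f : (Fin q → ℝ) → (Fin d → ℝ) → ℝ)
    (f' : ℕ → (Fin q → ℝ) → (Fin d → ℝ) → ℝ)
    (hf : ∀ t ∈ StableField.cube q T, StableField.IsKernel α m (f t))
    (hsupp : ∀ t ∈ StableField.cube q T, Function.support (f t) ⊆ StableField.cube d A)
    (hf' : ∀ n, ∀ t ∈ StableField.cube q T, StableField.IsKernel α m (f' n t))
    (X : (Fin q → ℝ) → Ω → ℝ) (X' : ℕ → (Fin q → ℝ) → Ω → ℝ)
    (hX : ∀ t ∈ StableField.cube q T,
      StableField.IsStochasticIntegral P m M (f t) Set.univ (X t))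
    (hX' : ∀ n, ∀ t ∈ StableField.cube q T,
      StableField.IsStochasticIntegral P m M (f' n t) (StableField.cube d A) (X' n t))
    (s : ℝ) (hs : StableField.IsErrExponent α m (StableField.cube d A) β s)
    (hErr : ∀ t ∈ StableField.cube q T,
      Tendsto (fun n => StableField.kernelErr m (StableField.cube d A) s (f t) (f' n t))
        atTop (𝓝 0)) :
    StableField.TendstoFiniteDim P (StableField.cube q T) X' X := by
  have hW : MeasurableSet (StableField.cube d A) := measurableSet_Icc
  intro k τ hτ
  refine TendstoInMeasure.tendstoInDistribution
    (StableField.tendstoInMeasure_pi (f := fun n j => X' n (τ j)) fun j =>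
      StableField.tendstoInMeasure_stochasticIntegral hM hα hW hm hs
        (hf _ (hτ j)).1.aestronglyMeasurable.aemeasurable
        (fun n => (hf' n _ (hτ j)).1.aestronglyMeasurable.aemeasurable) (hsupp _ (hτ j))
        (hX _ (hτ j)) (fun n => hX' n _ (hτ j)) (hErr _ (hτ j))) fun n => ?_
  exact aemeasurable_pi_lambda _ fun j => (hX' n _ (hτ j)).aemeasurable hM hW
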